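/- Let $0<q<1$. Let $C(SU_q(2))$ be the universal unital $C^*$-algebra generated by elements $u_{ij}$, $1\le i,j\le 2$, subject to the relations $$\sum_{k}u_{ik}u_{jk}^*=\delta_{ij},\qquad \sum_k u_{ki}^*u_{kj}=\delta_{ij},\qquad \sum_{i_1,i_2}E_{i_1i_2}u_{j_1i_1}u_{j_2i_2}=E_{j_1j_2},$$ where $E_{11}=E_{22}=0$, $E_{12}=1$, $E_{21}=-q$, and let $u_q=(u_{ij})\in M_2(C(SU_q(2)))$ be its fundamental unitary. Let $\{e_{n,m}:n\in\mathbb Z,\ m\in\mathbb N\}$, $\mathbb N=\{0,1,2,\dots\}$, be the standard orthonormal basis of $\ell^2(\mathbb Z)\otimes\ell^2(\mathbb N)$. Let $t$ be the unitary $te_n=e_{n-1}$ on $\ell^2(\mathbb Z)$; on $\ell^2(\mathbb N)$ let $Se_m=e_{m-1}$ for $m\ge1$, $Se_0=0$, let $Ne_m=me_m$, and put $p=1-S^*S$. Let $\chi_{s_1}:C(SU_q(2))\to B(\ell^2(\mathbb Z)\otimes\ell^2(\mathbb N))$ be the representation $$\chi_{s_1}(u_{11})=t^*\otimes\sqrt{1-q^{2N+2}}\,S,\quad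 \chi_{s_1}(u_{12})=-t^*\otimes q^{N+1},\quad \chi_{s_1}(u_{21})=t\otimes q^{N},\quad \chi_{s_1}(u_{22})=t\otimes S^*\sqrt{1-q^{2N+2}}.$$ For $k\in\mathbb Z$ let $P_k$ be the orthogonal projection onto the closed span of $\{e_{n,m}:n+m\le k\}$ and let $F_k=2P_k-1$. Then for every integer $k$ the triple $(\chi_{s_1},\ \ell^2(\mathbb Z)\otimes\ell^2(\mathbb N),\ F_k)$ is an odd Fredholm module for $C(SU_q(2))$, that is, $F_k=F_k^*$, $F_k^2=1$ and $[F_k,\chi_{s_1}(a)]$ is compact for all $a\in C(SU_q(2))$. For a unitary $U\in M_n(C(SU_q(2)))$ let $\langle [U],F_k\rangle$ be the Fredholm index ($\dim\ker-\dim\operatorname{coker}$) of the compression of $\chi_{s_1}(U)$ to $n$ copies of the range of $P_k$. Then 1. this compression is Fredholm for $U=u_q$, and $\langle[u_q],F_k\rangle=-1$; 2. $t\otimes p+1-1\otimes p$ is the image under $\chi_{s_1}$ of a unitary $v\in C(SU_q(2))$ whose compression is Fredholm, and $\langle[v],F_k\rangle=-1$. -/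

import Mathlib

open scoped ENNReal lp

noncomputable section

namespace QuantumSU2

/-! ### The universal C⋆-algebra `C(SU_q(2))` -/

/-- The coefficients `E_{i j}`: `E_{1 1} = E_{2 2} = 0`, `E_{1 2} = 1`, `E_{2 1} = -q`. -/
def detCoeff (q : ℝ) : Matrix (Fin 2) (Fin 2) ℂ := !![0, 1; -(q : ℂ), 0]

/-- The defining relations of `C(SU_q(2))` for a `2 × 2` matrix `u` over a C⋆-algebra:
`u` is unitary, and `∑ E_{i₁ i₂} u_{j₁ i₁} u_{j₂ i₂} = E_{j₁ j₂}` for all `j₁, j₂`. -/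
structure IsSUq2Matrix (q : ℝ) {B : Type*} [CStarAlgebra B] (u : Matrix (Fin 2) (Fin 2) B) :
    Prop where
  row : ∀ i j, ∑ k, u i k * star (u j k) = if i = j then 1 else 0
  col : ∀ i j, ∑ k, star (u k i) * u k j = if i = j then 1 else 0
  det : ∀ j₁ j₂, ∑ i₁, ∑ i₂, detCoeff q i₁ i₂ • (u j₁ i₁ * u j₂ i₂) = detCoeff q j₁ j₂ • (1 : B)

/-- A nonzero unital C⋆-algebra together with a matrix satisfying the relations. -/
structure Realization (q : ℝ) : Type 1 where
  B : Type
  [cstar : CStarAlgebra B]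
  [nontriv : Nontrivial B]
  u : Matrix (Fin 2) (Fin 2) B
  rel : IsSUq2Matrix q u

attribute [instance] Realization.cstar Realization.nontriv

/-- The C⋆-algebraic product of all realizations. -/
abbrev Ambient (q : ℝ) : Type 1 := lp (fun ρ : Realization q => ρ.B) ∞

instance ambientCStarAlgebra (q : ℝ) : CStarAlgebra (Ambient q) where
  toNormedRing := lp.inftyNormedRing
  toStarRing := lp.inftyStarRing
  toCompleteSpace := inferInstance
  toCStarRing := lp.inftyCStarRing
  toNormedAlgebra := lp.inftyNormedAlgebra
  toStarModule := inferInstance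

open scoped CStarAlgebra in
theorem IsSUq2Matrix.norm_entry_le {q : ℝ} {B : Type*} [CStarAlgebra B]
    {u : Matrix (Fin 2) (Fin 2) B} (h : IsSUq2Matrix q u) (i j : Fin 2) : ‖u i j‖ ≤ 1 := by
  let _ := CStarAlgebra.spectralOrder B
  have := CStarAlgebra.spectralOrderedRing B
  have h1 := h.col j j
  have h2 : star (u i j) * u i j ≤ 1 := by
    rw [if_pos rfl] at h1
    rw [← h1]
    exact Finset.single_le_sum (f := fun k => star (u k j) * u k j)
      (fun k _ => star_mul_self_nonneg _) (Finset.mem_univ i)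
  have h3 := CStarAlgebra.norm_le_norm_of_nonneg_of_le (star_mul_self_nonneg _) h2
  rw [CStarRing.norm_star_mul_self] at h3
  rcases subsingleton_or_nontrivial B with hB | hB
  · rw [Subsingleton.elim (u i j) 0]; simp
  · rw [CStarRing.norm_one] at h3
    nlinarith [norm_nonneg (u i j)]

/-- The canonical generators in the product of all realizations. -/
def ambientGen (q : ℝ) (i j : Fin 2) : Ambient q :=
  ⟨fun ρ => ρ.u i j, memℓp_infty ⟨1, by rintro _ ⟨ρ, rfl⟩; exact ρ.rel.norm_entry_le i j⟩⟩

/-- The closed unital star subalgebra generated by the canonical generators. -/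
def subalg (q : ℝ) : StarSubalgebra ℂ (Ambient q) :=
  (StarAlgebra.adjoin ℂ
    (Set.range fun ij : Fin 2 × Fin 2 => ambientGen q ij.1 ij.2)).topologicalClosure

/-- `C(SU_q(2))`, the universal unital C⋆-algebra generated by the entries of a `2 × 2` matrix
subject to `IsSUq2Matrix q`. It is realized as the closed star subalgebra that the generators
span in the product of all realizations, so that its norm is the largest C⋆-seminorm. -/
def CSUq2 (q : ℝ) : Type 1 := subalg q

instance isClosed_subalg (q : ℝ) : IsClosed (subalg q : Set (Ambient q)) :=
  StarSubalgebra.isClosed_topologicalClosure _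

instance cstarAlgebraCSUq2 (q : ℝ) : CStarAlgebra (CSUq2 q) :=
  StarSubalgebra.cstarAlgebra (subalg q)

/-- The generators `u_{ij}` of `C(SU_q(2))`. -/
def gen (q : ℝ) : Matrix (Fin 2) (Fin 2) (CSUq2 q) := fun i j =>
  ⟨ambientGen q i j, StarSubalgebra.le_topologicalClosure _
    (StarAlgebra.subset_adjoin ℂ _ ⟨(i, j), rfl⟩)⟩

/-- Evaluation at one realization. -/
def evalHom {q : ℝ} (ρ : Realization q) : CSUq2 q →⋆ₐ[ℂ] ρ.B where
  toFun a := a.1 ρ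
  map_one' := rfl
  map_mul' _ _ := rfl
  map_zero' := rfl
  map_add' _ _ := rfl
  commutes' _ := rfl
  map_star' _ := rfl

theorem ext_evalHom {q : ℝ} {a b : CSUq2 q} (h : ∀ ρ, evalHom ρ a = evalHom ρ b) : a = b :=
  Subtype.ext (lp.ext (funext h))

theorem evalHom_gen {q : ℝ} (ρ : Realization q) (i j : Fin 2) :
    evalHom ρ (gen q i j) = ρ.u i j := rfl

theorem isSUq2Matrix_gen (q : ℝ) : IsSUq2Matrix q (gen q) where
  row i j := ext_evalHom fun ρ => by
    rw [map_sum, apply_ite (evalHom ρ), map_one, map_zero, ← ρ.rel.row i j]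
    simp only [map_mul, map_star, evalHom_gen]
  col i j := ext_evalHom fun ρ => by
    rw [map_sum, apply_ite (evalHom ρ), map_one, map_zero, ← ρ.rel.col i j]
    simp only [map_mul, map_star, evalHom_gen]
  det i j := ext_evalHom fun ρ => by
    rw [map_sum, map_smul, map_one, ← ρ.rel.det i j]
    simp only [map_sum, map_smul, map_mul, evalHom_gen]

/-- The universal property: a matrix satisfying the relations in a nonzero C⋆-algebra induces a
unital star homomorphism. -/
def lift {q : ℝ} {B : Type} [CStarAlgebra B] [Nontrivial B] (u : Matrix (Fin 2) (Fin 2) B)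
    (hu : IsSUq2Matrix q u) : CSUq2 q →⋆ₐ[ℂ] B :=
  evalHom ⟨B, u, hu⟩

theorem lift_gen {q : ℝ} {B : Type} [CStarAlgebra B] [Nontrivial B]
    (u : Matrix (Fin 2) (Fin 2) B) (hu : IsSUq2Matrix q u) (i j : Fin 2) :
    lift u hu (gen q i j) = u i j := rfl

/-- The fundamental unitary `u_q = (u_{ij})`. -/
def fundamentalUnitary (q : ℝ) : unitary (Matrix (Fin 2) (Fin 2) (CSUq2 q)) :=
  ⟨gen q, by
    rw [Unitary.mem_iff]
    constructor
    · ext1 i j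
      exact ((isSUq2Matrix_gen q).col i j).trans (Matrix.one_apply).symm
    · ext1 i j
      exact ((isSUq2Matrix_gen q).row i j).trans (Matrix.one_apply).symm⟩

/-! ### Operators on `ℓ²(ℤ) ⊗ ℓ²(ℕ) = ℓ²(ℤ × ℕ)` -/

/-- The Hilbert space `ℓ²(ℤ) ⊗ ℓ²(ℕ)`, with orthonormal basis indexed by `ℤ × ℕ`. -/
abbrev Hil : Type := ℓ²(ℤ × ℕ, ℂ)

/-- The basis vector `e_{n,m} = e_n ⊗ e_m`. -/
def e (n : ℤ) (m : ℕ) : Hil := lp.single 2 (n, m) (1 : ℂ)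

/-- The contraction `(T x)(i) = w i * x (g i)`, for `|w| ≤ 1` and `g` injective. -/
def weightedComp (w : ℤ × ℕ → ℂ) (hw : ∀ i, ‖w i‖ ≤ 1) (g : ℤ × ℕ → ℤ × ℕ)
    (hg : Function.Injective g) : Hil →L[ℂ] Hil :=
  have key : ∀ x : Hil, ∀ i, ‖w i * x (g i)‖ ^ (2 : ℝ≥0∞).toReal ≤
      ‖x (g i)‖ ^ (2 : ℝ≥0∞).toReal := fun x i => by
    refine Real.rpow_le_rpow (norm_nonneg _) ?_ (by simp)
    rw [norm_mul]
    exact mul_le_of_le_one_left (norm_nonneg _) (hw i)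
  have hs : ∀ x : Hil, Summable fun i => ‖x i‖ ^ (2 : ℝ≥0∞).toReal := fun x =>
    (lp.memℓp x).summable (by simp)
  have hsum : ∀ x : Hil, Summable fun i => ‖w i * x (g i)‖ ^ (2 : ℝ≥0∞).toReal := fun x =>
    Summable.of_nonneg_of_le (fun i => by positivity) (key x) ((hs x).comp_injective hg)
  LinearMap.mkContinuous
    { toFun := fun x => ⟨fun i => w i * x (g i), memℓp_gen (hsum x)⟩
      map_add' := fun x y => by
        ext i
        exact mul_add _ _ _
      map_smul' := fun c x => by
        ext i
        exact mul_left_comm _ _ _ }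
    1 fun x => by
      rw [one_mul]
      refine lp.norm_le_of_tsum_le (by simp) (norm_nonneg _) ?_
      rw [lp.norm_rpow_eq_tsum (by simp) x]
      exact (Summable.tsum_le_tsum (key x) (hsum x) ((hs x).comp_injective hg)).trans
        (((hs x).comp_injective hg).tsum_le_tsum_of_inj g hg (fun _ _ => by positivity)
          (fun _ => le_rfl) (hs x))

theorem weightedComp_apply (w : ℤ × ℕ → ℂ) (hw : ∀ i, ‖w i‖ ≤ 1) (g : ℤ × ℕ → ℤ × ℕ)
    (hg : Function.Injective g) (x : Hil) (i : ℤ × ℕ) :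
    weightedComp w hw g hg x i = w i * x (g i) := rfl

/-- `t ⊗ 1`, where `t e_n = e_{n-1}`. -/
def tOp : Hil →L[ℂ] Hil :=
  weightedComp (fun _ => 1) (fun _ => by simp) (fun i => (i.1 + 1, i.2))
    (fun i j h => by
      rw [Prod.mk.injEq] at h
      exact Prod.ext (add_right_cancel h.1) h.2)

/-- `1 ⊗ S`, where `S e_m = e_{m-1}` and `S e_0 = 0`. -/
def SOp : Hil →L[ℂ] Hil :=
  weightedComp (fun _ => 1) (fun _ => by simp) (fun i => (i.1, i.2 + 1))
    (fun i j h => by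
      rw [Prod.mk.injEq] at h
      exact Prod.ext h.1 (add_right_cancel h.2))

/-- `1 ⊗ f(N)`, where `f(N) e_m = f(m) e_m`. -/
def diagOp (f : ℕ → ℝ) (hf : ∀ m, |f m| ≤ 1) : Hil →L[ℂ] Hil :=
  weightedComp (fun i => (f i.2 : ℂ)) (fun i => by simpa using hf i.2) id Function.injective_id

theorem abs_pow_le {q : ℝ} (hq : q ∈ Set.Ioo (0 : ℝ) 1) (m : ℕ) : |q ^ m| ≤ 1 := by
  rw [abs_of_nonneg (pow_nonneg hq.1.le m)]
  exact pow_le_one₀ hq.1.le hq.2.le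

theorem abs_sqrt_le {q : ℝ} (hq : q ∈ Set.Ioo (0 : ℝ) 1) (m : ℕ) :
    |Real.sqrt (1 - q ^ (2 * m + 2))| ≤ 1 := by
  rw [abs_of_nonneg (Real.sqrt_nonneg _), Real.sqrt_le_one]
  linarith [pow_nonneg hq.1.le (2 * m + 2)]

/-- `1 ⊗ q^N`. -/
def qN {q : ℝ} (hq : q ∈ Set.Ioo (0 : ℝ) 1) : Hil →L[ℂ] Hil :=
  diagOp (fun m => q ^ m) (abs_pow_le hq)

/-- `1 ⊗ q^{N+1}`. -/
def qN1 {q : ℝ} (hq : q ∈ Set.Ioo (0 : ℝ) 1) : Hil →L[ℂ] Hil :=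
  diagOp (fun m => q ^ (m + 1)) (fun m => abs_pow_le hq (m + 1))

/-- `1 ⊗ √(1 - q^{2N+2})`. -/
def rootN {q : ℝ} (hq : q ∈ Set.Ioo (0 : ℝ) 1) : Hil →L[ℂ] Hil :=
  diagOp (fun m => Real.sqrt (1 - q ^ (2 * m + 2))) (abs_sqrt_le hq)

/-- The images of the generators under `χ_{s₁}`, that is, of `τ_t * π_{s₁}` with
`τ_t(u) = diag(t̄, t)`:
`u₁₁ ↦ t̄ ⊗ √(1-q^{2N+2}) S`, `u₁₂ ↦ - t̄ ⊗ q^{N+1}`,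
`u₂₁ ↦ t ⊗ q^N`, `u₂₂ ↦ t ⊗ S⋆ √(1-q^{2N+2})`. -/
def chiMatrix {q : ℝ} (hq : q ∈ Set.Ioo (0 : ℝ) 1) : Matrix (Fin 2) (Fin 2) (Hil →L[ℂ] Hil) :=
  !![star tOp * (rootN hq * SOp), -(star tOp * qN1 hq);
     tOp * qN hq, tOp * (star SOp * rootN hq)]

theorem tOp_apply (x : Hil) (n : ℤ) (m : ℕ) : tOp x (n, m) = x (n + 1, m) := one_mul _

theorem SOp_apply (x : Hil) (n : ℤ) (m : ℕ) : SOp x (n, m) = x (n, m + 1) := one_mul _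

theorem diagOp_apply (f : ℕ → ℝ) (hf : ∀ m, |f m| ≤ 1) (x : Hil) (n : ℤ) (m : ℕ) :
    diagOp f hf x (n, m) = (f m : ℂ) * x (n, m) := rfl

theorem inner_e (n : ℤ) (m : ℕ) (x : Hil) : inner ℂ (e n m) x = x (n, m) := by
  rw [e, lp.inner_single_left]
  simp

theorem e_apply (n n' : ℤ) (m m' : ℕ) :
    e n m (n', m') = if n' = n ∧ m' = m then 1 else 0 := by
  rw [e, lp.single_apply, Pi.single_apply]
  simp

theorem star_apply (T : Hil →L[ℂ] Hil) (x : Hil) (n : ℤ) (m : ℕ) :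
    star T x (n, m) = inner ℂ (T (e n m)) x := by
  rw [← inner_e, ContinuousLinearMap.star_eq_adjoint, ContinuousLinearMap.adjoint_inner_right]

theorem tOp_e (n : ℤ) (m : ℕ) : tOp (e n m) = e (n - 1) m := by
  ext ⟨n', m'⟩
  rw [tOp_apply, e_apply, e_apply]
  simp only [eq_sub_iff_add_eq]

theorem SOp_e_zero (n : ℤ) : SOp (e n 0) = 0 := by
  ext ⟨n', m'⟩
  rw [SOp_apply, e_apply]
  simp

theorem SOp_e_succ (n : ℤ) (m : ℕ) : SOp (e n (m + 1)) = e n m := by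
  ext ⟨n', m'⟩
  rw [SOp_apply, e_apply, e_apply]
  simp

theorem diagOp_e (f : ℕ → ℝ) (hf : ∀ m, |f m| ≤ 1) (n : ℤ) (m : ℕ) :
    diagOp f hf (e n m) = (f m : ℂ) • e n m := by
  ext ⟨n', m'⟩
  rw [diagOp_apply, lp.coeFn_smul, Pi.smul_apply, e_apply]
  split_ifs with h
  · rw [h.2, smul_eq_mul]
  · simp

theorem star_tOp_apply (x : Hil) (n : ℤ) (m : ℕ) : star tOp x (n, m) = x (n - 1, m) := by
  rw [star_apply, tOp_e, inner_e]

theorem star_SOp_apply_zero (x : Hil) (n : ℤ) : star SOp x (n, 0) = 0 := by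
  rw [star_apply, SOp_e_zero, inner_zero_left]

theorem star_SOp_apply_succ (x : Hil) (n : ℤ) (m : ℕ) : star SOp x (n, m + 1) = x (n, m) := by
  rw [star_apply, SOp_e_succ, inner_e]

theorem star_diagOp (f : ℕ → ℝ) (hf : ∀ m, |f m| ≤ 1) : star (diagOp f hf) = diagOp f hf := by
  ext x ⟨n, m⟩
  rw [star_apply, diagOp_e, inner_smul_left, inner_e, diagOp_apply, Complex.conj_ofReal]

theorem hil_smul_apply (c : ℂ) (x : Hil) (i : ℤ × ℕ) : (c • x) i = c * x i := rfl

theorem hil_neg_apply (x : Hil) (i : ℤ × ℕ) : (-x) i = -x i := rfl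

theorem hil_add_apply (x y : Hil) (i : ℤ × ℕ) : (x + y) i = x i + y i := rfl

theorem root_mul {q : ℝ} (hq : q ∈ Set.Ioo (0 : ℝ) 1) (m : ℕ) (z : ℂ) :
    ((Real.sqrt (1 - q ^ (2 * m + 2)) : ℝ) : ℂ) *
      (((Real.sqrt (1 - q ^ (2 * m + 2)) : ℝ) : ℂ) * z) = (1 - (q : ℂ) ^ (2 * m + 2)) * z := by
  rw [← mul_assoc, ← Complex.ofReal_mul, Real.mul_self_sqrt]
  · push_cast; rfl
  · linarith [pow_le_one₀ hq.1.le hq.2.le (n := 2 * m + 2)]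

theorem root_mul_zero {q : ℝ} (hq : q ∈ Set.Ioo (0 : ℝ) 1) (z : ℂ) :
    ((Real.sqrt (1 - q ^ 2) : ℝ) : ℂ) * (((Real.sqrt (1 - q ^ 2) : ℝ) : ℂ) * z) =
      (1 - (q : ℂ) ^ 2) * z := by
  simpa using root_mul hq 0 z

set_option linter.unusedSimpArgs false in
set_option maxHeartbeats 2000000 in
theorem isSUq2Matrix_chiMatrix {q : ℝ} (hq : q ∈ Set.Ioo (0 : ℝ) 1) :
    IsSUq2Matrix q (chiMatrix hq) := by
  constructor
  · intro i j
    ext x ⟨n, m⟩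
    fin_cases i <;> fin_cases j <;> rcases m with _ | m <;>
    simp [chiMatrix, Fin.sum_univ_two, tOp_apply, SOp_apply, qN, qN1, rootN, diagOp_apply,
      star_tOp_apply, star_SOp_apply_zero, star_SOp_apply_succ, star_diagOp, root_mul hq,
      root_mul_zero hq] <;> ring
  · intro i j
    ext x ⟨n, m⟩
    fin_cases i <;> fin_cases j <;> rcases m with _ | m <;>
    simp [chiMatrix, Fin.sum_univ_two, tOp_apply, SOp_apply, qN, qN1, rootN, diagOp_apply,
      star_tOp_apply, star_SOp_apply_zero, star_SOp_apply_succ, star_diagOp, root_mul hq,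
      root_mul_zero hq] <;> ring
  · intro i j
    ext x ⟨n, m⟩
    fin_cases i <;> fin_cases j <;> rcases m with _ | m <;>
    simp [chiMatrix, Fin.sum_univ_two, tOp_apply, SOp_apply, qN, qN1, rootN, diagOp_apply,
      star_tOp_apply, star_SOp_apply_zero, star_SOp_apply_succ, star_diagOp, root_mul hq,
      root_mul_zero hq, detCoeff,
      hil_smul_apply, hil_neg_apply, hil_add_apply, -lp.coeFn_smul, -lp.coeFn_neg, -lp.coeFn_add,
      -Complex.coe_smul] <;> ring

theorem e_ne_zero (n : ℤ) (m : ℕ) : e n m ≠ 0 := fun h => by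
  have h1 := e_apply n n m m
  rw [h, if_pos ⟨rfl, rfl⟩] at h1
  exact zero_ne_one h1

instance nontrivialHil : Nontrivial Hil := ⟨e 0 0, 0, e_ne_zero 0 0⟩

/-- The representation `χ_{s₁}` of `C(SU_q(2))` on `ℓ²(ℤ) ⊗ ℓ²(ℕ)`. -/
def chi {q : ℝ} (hq : q ∈ Set.Ioo (0 : ℝ) 1) : CSUq2 q →⋆ₐ[ℂ] (Hil →L[ℂ] Hil) :=
  lift (chiMatrix hq) (isSUq2Matrix_chiMatrix hq)

/-- `1 ⊗ p` with `p = 1 - S⋆ S`. -/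
def pOp : Hil →L[ℂ] Hil := 1 - star SOp * SOp

/-- `P_k`, the orthogonal projection onto the closed span of `{e_{n,m} : n + m ≤ k}`. -/
def P (k : ℤ) : Hil →L[ℂ] Hil :=
  (Submodule.span ℂ {x : Hil | ∃ (n : ℤ) (m : ℕ), n + m ≤ k ∧ x = e n m}).topologicalClosure
    |>.starProjection

/-- `F_k = 2 P_k - 1`. -/
def F (k : ℤ) : Hil →L[ℂ] Hil := (2 : ℂ) • P k - 1

/-! ### Odd Fredholm modules and the index pairing -/

section Fredholm

variable {A : Type*} [CStarAlgebra A]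
  {H : Type*} [NormedAddCommGroup H] [InnerProductSpace ℂ H] [CompleteSpace H]

/-- `(π, H, G)` is an odd Fredholm module over `A`: `G` is a self-adjoint unitary on `H` and
`[G, π(a)]` is compact for every `a`. -/
structure IsOddFredholmModule (π : A →⋆ₐ[ℂ] (H →L[ℂ] H)) (G : H →L[ℂ] H) : Prop where
  selfAdjoint : IsSelfAdjoint G
  sq_eq_one : G * G = 1
  compact_commutator : ∀ a, IsCompactOperator (G * π a - π a * G)

/-- The `+1`-eigenspace of `G`. For a self-adjoint unitary `G` this is the range of the
projection `(1 + G) / 2`. -/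
abbrev posSpace (G : H →L[ℂ] H) : Submodule ℂ H := LinearMap.ker (G - 1 : H →L[ℂ] H).toLinearMap

instance completeSpace_posSpace (G : H →L[ℂ] H) : CompleteSpace (posSpace G) :=
  ContinuousLinearMap.completeSpace_ker (G - 1)

/-- The compression of `π(U)`, for a unitary matrix `U` over `A`, to the direct sum of `n` copies
of the positive space of `G`: with `E` the orthogonal projection onto that space, the entries
are `E π(U_{ij}) E`. -/
def compression (π : A →⋆ₐ[ℂ] (H →L[ℂ] H)) (G : H →L[ℂ] H) {n : ℕ}
    (U : unitary (Matrix (Fin n) (Fin n) A)) :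
    (Fin n → posSpace G) →L[ℂ] (Fin n → posSpace G) :=
  ContinuousLinearMap.pi fun i => ∑ j,
    ((posSpace G).orthogonalProjectionOnto ∘L π (U.1 i j) ∘L (posSpace G).subtypeL) ∘L
      ContinuousLinearMap.proj j

/-- The index `dim ker T - dim coker T`. -/
def fredholmIndex {V : Type*} [AddCommGroup V] [Module ℂ V] [TopologicalSpace V]
    (T : V →L[ℂ] V) : ℤ :=
  (Module.finrank ℂ (LinearMap.ker T.toLinearMap) : ℤ) -
    Module.finrank ℂ (V ⧸ LinearMap.range T.toLinearMap)

/-- The index pairing `⟨[U], G⟩`, the Fredholm index of the compression of `π(U)` to the positive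
space of `G`. -/
def indexPairing (π : A →⋆ₐ[ℂ] (H →L[ℂ] H)) (G : H →L[ℂ] H) {n : ℕ}
    (U : unitary (Matrix (Fin n) (Fin n) A)) : ℤ :=
  fredholmIndex (compression π G U)

end Fredholm

end QuantumSU2

end

namespace QuantumSU2

/-! Everything is read off from the degree `n + m` of `e_{n,m}`, since `P_k` keeps exactly the
coordinates of degree at most `k`. The diagonal generators preserve the degree and commute with
`F_k`. The off-diagonal ones and their adjoints move `n` by one with weights proportional to `q^m`,
so their commutator with `F_k` lives on one antidiagonal, with summable weights, and is compact.
Compactness passes to all of `C(SU_q(2))` by the Leibniz rule and norm continuity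
(`isCompactOperator_commutator_lift`).

Let `T` be the compression of `u_q`, and index components by 0 and 1. The pair `(f₀(n,m+1),
f₁(n,m))` is sent to the coordinates `(n+1,m)` of component 0 and `(n-1,m+1)` of component 1 by a
rotation with entries `√(1-q^{2m+2})` and `±q^{m+1}`. For `n + m < k` the whole block survives the
cutoff; for `n + m = k` only the nonzero entry `√(1-q^{2m+2})` from `f₁` remains, and it is bounded
below uniformly in `m`. The leftover coordinates `f₀(n,0)` are shifted to `(n-1,0)` in component 1,
which misses only `(k,0)`. So `T` is injective, its range is one coordinate hyperplane, and the
index is `-1`.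

For `v`, put `z = u₂₁`. The relations force a gap in the spectrum of `z⋆z` below `1`
(`IsSUq2Matrix.spectrum_gap`), so its spectral projection `r` at `1` lies in the algebra. Since
`χ(z⋆z) = 1 ⊗ q^{2N}`, `χ(r) = 1 ⊗ p`, and `v = zr + 1 - r` has the required image. Its compression
shifts the row `m = 0`, again missing only `(k,0)`, and is the identity on the other rows. -/

/-- An injective operator on a Banach space whose range is a closed hyperplane is Fredholm of
index `-1`. -/
theorem isFredholm_and_fredholmIndex_of_range_eq_ker {V : Type*} [NormedAddCommGroup V]
    [NormedSpace ℂ V] [CompleteSpace V] (T : V →L[ℂ] V) (φ : V →L[ℂ] ℂ)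
    (hinj : Function.Injective T) (hφ : Function.Surjective φ)
    (hrange : T.range = φ.ker) :
    T.IsFredholm ∧ fredholmIndex T = -1 := by
  have hclosed : IsClosed (T.range : Set V) := by rw [hrange]; exact φ.isClosed_ker
  have hker : T.ker = ⊥ := LinearMap.ker_eq_bot.2 hinj
  have eqv : (V ⧸ T.range) ≃ₗ[ℂ] ℂ :=
    (Submodule.quotEquivOfEq _ _ hrange).trans (φ.toLinearMap.quotKerEquivOfSurjective hφ)
  refine ⟨⟨?_, hclosed, ?_, ?_, ?_⟩, ?_⟩
  · obtain ⟨K, hK⟩ := T.antilipschitz_of_injective_of_isClosed_range hinj hclosed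
    exact (hK.isEmbedding T.continuous).isStrictMap
  · rw [hker]; infer_instance
  · exact Module.Finite.equiv eqv.symm
  · rw [hker]; exact Submodule.closedComplemented_bot
  · have h1 := eqv.finrank_eq
    rw [Module.finrank_self] at h1
    rw [fredholmIndex, h1, hker]
    simp

/-! ### The projections `P_k` in coordinates -/

theorem P_apply (k : ℤ) (x : Hil) (n : ℤ) (m : ℕ) :
    P k x (n, m) = if n + m ≤ k then x (n, m) else 0 := by
  let D : Hil →L[ℂ] Hil := weightedComp (fun i => if i.1 + i.2 ≤ k then 1 else 0)
    (fun i => by split_ifs <;> simp) id Function.injective_id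
  have hD : ∀ x : Hil, ∀ i, D x i = (if i.1 + i.2 ≤ k then 1 else 0) * x i := fun _ _ => rfl
  have h : P k x = D x := by
    refine Submodule.eq_starProjection_of_mem_orthogonal (K := (Submodule.span ℂ
      {x : Hil | ∃ (n : ℤ) (m : ℕ), n + m ≤ k ∧ x = e n m}).topologicalClosure) ?_ ?_
    -- The closed span is handled as a double orthogonal complement: vectors orthogonal to the span
    -- have zero coordinates wherever `D x` can be nonzero.
    · rw [← Submodule.orthogonal_orthogonal_eq_closure, Submodule.mem_orthogonal]
      intro y hy
      rw [Submodule.mem_orthogonal] at hy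
      rw [lp.inner_eq_tsum]
      convert tsum_zero with i
      rw [hD]
      split_ifs with hi
      · have := hy _ (Submodule.subset_span ⟨i.1, i.2, hi, rfl⟩)
        rw [inner_e] at this
        simp [this]
      · simp
    · rw [Submodule.orthogonal_closure, Submodule.mem_orthogonal]
      intro y hy
      induction hy using Submodule.span_induction with
      | mem y hy =>
        obtain ⟨n, m, hnm, rfl⟩ := hy
        rw [inner_e]
        simp [hD, hnm]
      | zero => simp
      | add y z _ _ hy hz => rw [inner_add_left, hy, hz, add_zero]
      | smul c y _ hy => rw [inner_smul_left, hy, mul_zero]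
  rw [h, hD]
  simp

theorem F_apply (k : ℤ) (x : Hil) (n : ℤ) (m : ℕ) :
    F k x (n, m) = if n + m ≤ k then x (n, m) else -x (n, m) := by
  have h : F k x (n, m) = 2 * P k x (n, m) - x (n, m) := rfl
  rw [h, P_apply]
  split_ifs <;> ring

theorem mem_posSpace_F {k : ℤ} {x : Hil} :
    x ∈ posSpace (F k) ↔ ∀ (n : ℤ) (m : ℕ), k < n + m → x (n, m) = 0 := by
  have h : x ∈ posSpace (F k) ↔ F k x = x := by
    simp [posSpace, sub_eq_zero]
  rw [h]
  constructor
  · intro hx n m hnm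
    have h1 := F_apply k x n m
    rw [hx, if_neg (not_le.2 hnm)] at h1
    exact self_eq_neg.1 h1
  · intro hx
    ext ⟨n, m⟩
    rw [F_apply]
    split_ifs with hnm
    · rfl
    · rw [hx n m (not_le.1 hnm), neg_zero]

theorem P_mem_posSpace (k : ℤ) (x : Hil) : P k x ∈ posSpace (F k) :=
  mem_posSpace_F.2 fun n m h => by rw [P_apply, if_neg (not_le.2 h)]

theorem orthogonalProjectionOnto_posSpace_apply (k : ℤ) (x : Hil) (n : ℤ) (m : ℕ) :
    ((posSpace (F k)).orthogonalProjectionOnto x : Hil) (n, m) =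
      if n + m ≤ k then x (n, m) else 0 := by
  have h : ((posSpace (F k)).orthogonalProjectionOnto x : Hil) = P k x := by
    refine Submodule.eq_starProjection_of_mem_orthogonal (P_mem_posSpace k x) ?_
    rw [Submodule.mem_orthogonal]
    intro y hy
    rw [lp.inner_eq_tsum]
    convert tsum_zero with i
    have h1 : (x - P k x) i = x i - P k x i := rfl
    rw [h1, P_apply]
    split_ifs with hi
    · simp
    · rw [mem_posSpace_F.1 hy i.1 i.2 (not_le.1 hi)]
      simp
  rw [h, P_apply]

theorem isSelfAdjoint_F (k : ℤ) : IsSelfAdjoint (F k) := by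
  have : IsSelfAdjoint (P k) := isSelfAdjoint_starProjection _
  refine IsSelfAdjoint.sub ?_ (IsSelfAdjoint.one _)
  rw [isSelfAdjoint_iff, star_smul, this.star_eq]
  simp

theorem F_mul_self (k : ℤ) : F k * F k = 1 := by
  ext x ⟨n, m⟩
  change F k (F k x) (n, m) = x (n, m)
  simp only [F_apply]
  split_ifs <;> simp

theorem compression_F_apply {A : Type*} [CStarAlgebra A] (π : A →⋆ₐ[ℂ] (Hil →L[ℂ] Hil)) (k : ℤ)
    {N : ℕ} (U : unitary (Matrix (Fin N) (Fin N) A)) (f : Fin N → posSpace (F k)) (i : Fin N)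
    (n : ℤ) (m : ℕ) :
    (compression π (F k) U f i : Hil) (n, m) =
      if n + m ≤ k then ∑ j, π (U.1 i j) (f j) (n, m) else 0 := by
  have h : compression π (F k) U f i =
      (posSpace (F k)).orthogonalProjectionOnto (∑ j, π (U.1 i j) (f j)) := by
    simp [compression]
  rw [h, orthogonalProjectionOnto_posSpace_apply, lp.coeFn_sum, Finset.sum_apply]

/-! ### Compactness of the commutators -/

/-- A weighted composition operator with summable weights is compact. -/
theorem isCompactOperator_of_summable_weights (T : Hil →L[ℂ] Hil) (w : ℤ × ℕ → ℂ)
    (g : ℤ × ℕ → ℤ × ℕ) (hT : ∀ x i, T x i = w i * x (g i)) (hw : Summable fun i => ‖w i‖) :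
    IsCompactOperator T := by
  have hinner : ∀ i (x : Hil), inner ℂ (lp.single 2 i (1 : ℂ) : Hil) x = x i := fun i x =>
    inner_e i.1 i.2 x
  have hnorm : ∀ i, ‖(lp.single 2 i (1 : ℂ) : Hil)‖ = 1 := fun i => by
    rw [lp.norm_single (by norm_num)]; simp
  -- The rank-one pieces `x ↦ w i * x (g i) • e_i` have norm `‖w i‖`, so `T` is their
  -- norm-convergent sum and a limit of finite-rank operators.
  let R : ℤ × ℕ → Hil →L[ℂ] Hil := fun i =>
    (w i • innerSL ℂ (lp.single 2 (g i) (1 : ℂ) : Hil)).smulRight (lp.single 2 i (1 : ℂ) : Hil)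
  have hR : ∀ i, IsCompactOperator (R i) := fun i => by
    have h1 : IsCompactOperator (w i • innerSL ℂ (lp.single 2 (g i) (1 : ℂ) : Hil)) := by
      have h2 : IsCompactOperator (id : ℂ → ℂ) :=
        ⟨Metric.closedBall 0 1, isCompact_closedBall _ _,
          Metric.closedBall_mem_nhds _ one_pos⟩
      exact h2.comp_clm (w i • innerSL ℂ (lp.single 2 (g i) (1 : ℂ) : Hil))
    exact h1.clm_comp (ContinuousLinearMap.toSpanSingleton ℂ (lp.single 2 i (1 : ℂ) : Hil))
  have hsum : Summable R := by
    refine Summable.of_norm_bounded hw fun i => ?_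
    rw [ContinuousLinearMap.norm_smulRight_apply, hnorm, mul_one, norm_smul, innerSL_apply_norm,
      hnorm, mul_one]
  have hTR : T = ∑' i, R i := by
    ext x j
    have h1 := (hsum.hasSum.mapL (ContinuousLinearMap.apply ℂ Hil x)).mapL
      (innerSL ℂ (lp.single 2 j (1 : ℂ) : Hil))
    have h2 : ∀ i, innerSL ℂ (lp.single 2 j (1 : ℂ) : Hil)
        (ContinuousLinearMap.apply ℂ Hil x (R i)) = if i = j then w j * x (g j) else 0 := by
      intro i
      have h3 : ContinuousLinearMap.apply ℂ Hil x (R i) =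
          (w i * x (g i)) • (lp.single 2 i (1 : ℂ) : Hil) := by
        simp [R, hinner]
      rw [h3, innerSL_apply_apply, hinner, hil_smul_apply, lp.single_apply, Pi.single_apply]
      by_cases hij : i = j
      · simp [hij]
      · simp [hij, Ne.symm hij]
    simp only [h2] at h1
    rw [hT]
    have h4 := (hasSum_ite_eq j (w j * x (g j))).unique h1
    rw [innerSL_apply_apply, hinner] at h4
    exact h4
  rw [hTR]
  refine isClosed_setOfPred_isCompactOperator.mem_of_tendsto hsum.hasSum
    (Filter.Eventually.of_forall fun s => ?_)
  exact (compactOperator (RingHom.id ℂ) Hil Hil).sum_mem fun i _ => hR i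

theorem summable_antidiagonal_pow {q : ℝ} (hq : q ∈ Set.Ioo (0 : ℝ) 1) (l : ℤ) :
    Summable fun i : ℤ × ℕ => if i.1 + i.2 = l then q ^ i.2 else 0 := by
  have hinj : Function.Injective fun m : ℕ => ((l - m, m) : ℤ × ℕ) := fun m m' h =>
    (Prod.ext_iff.1 h).2
  rw [← hinj.summable_iff]
  · simpa [Function.comp_def] using summable_geometric_of_lt_one hq.1.le hq.2
  · rintro ⟨n, m⟩ h
    refine if_neg fun h' => h ⟨m, ?_⟩
    ext <;> simp
    simp at h'
    omega

/-- The commutator sees only the coordinates where the shift crosses the boundary of `n + m ≤ k`;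
these form one antidiagonal, along which `q^m` is summable. -/
theorem isCompactOperator_commutator_of_shift {q : ℝ} (hq : q ∈ Set.Ioo (0 : ℝ) 1) (k : ℤ)
    (T : Hil →L[ℂ] Hil) (c : ℂ) (j : ℤ) (hj : j = 1 ∨ j = -1)
    (hT : ∀ x n m, T x (n, m) = c * (q : ℂ) ^ m * x (n + j, m)) :
    IsCompactOperator (F k * T - T * F k) := by
  -- The two signs differ only at `n + m = k` when `j = 1` (giving `2`), and only at `n + m = k + 1`
  -- when `j = -1` (giving `-2`).
  obtain ⟨l, s, hs⟩ : ∃ (l : ℤ) (s : ℂ), ∀ n : ℤ, ∀ m : ℕ, ∀ z : ℂ,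
      ((if n + m ≤ k then z else -z) - (if n + j + m ≤ k then z else -z)) =
        (if n + m = l then s else 0) * z := by
    rcases hj with rfl | rfl
    · refine ⟨k, 2, fun n m z => ?_⟩
      split_ifs <;> first | omega | ring
    · refine ⟨k + 1, -2, fun n m z => ?_⟩
      split_ifs <;> first | omega | ring
  refine isCompactOperator_of_summable_weights _
    (fun i => s * c * ((if i.1 + i.2 = l then q ^ i.2 else 0 : ℝ) : ℂ))
    (fun i => (i.1 + j, i.2)) ?_ ?_
  · rintro x ⟨n, m⟩
    change F k (T x) (n, m) - T (F k x) (n, m) = _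
    rw [F_apply, hT, hT, F_apply]
    have := hs n m (c * (q : ℂ) ^ m * x (n + j, m))
    rw [← mul_neg] at this
    split_ifs at this ⊢ <;> push_cast <;> first | omega | linear_combination this
  · simp only [norm_mul]
    refine Summable.mul_left _ ?_
    refine (summable_antidiagonal_pow hq l).norm.congr fun i => ?_
    rw [Complex.norm_real]

theorem commutator_eq_zero_of_preserves (k : ℤ) (T : Hil →L[ℂ] Hil)
    (hT : ∀ (n : ℤ) (m : ℕ), ∃ (c : ℂ) (n' : ℤ) (m' : ℕ), n' + m' = n + m ∧
      ∀ x, T x (n, m) = c * x (n', m')) :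
    F k * T - T * F k = 0 := by
  ext x ⟨n, m⟩
  change F k (T x) (n, m) - T (F k x) (n, m) = 0
  obtain ⟨c, n', m', h, hc⟩ := hT n m
  rw [F_apply, hc, hc, F_apply, h]
  split_ifs <;> ring

/-! ### The images of the generators and their adjoints in coordinates -/

theorem chiMatrix_apply_00 {q : ℝ} (hq : q ∈ Set.Ioo (0 : ℝ) 1) (x : Hil) (n : ℤ) (m : ℕ) :
    chiMatrix hq 0 0 x (n, m) =
      (Real.sqrt (1 - q ^ (2 * m + 2)) : ℂ) * x (n - 1, m + 1) := by
  change star tOp (rootN hq (SOp x)) (n, m) = _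
  rw [star_tOp_apply, rootN, diagOp_apply, SOp_apply]

theorem chiMatrix_apply_01 {q : ℝ} (hq : q ∈ Set.Ioo (0 : ℝ) 1) (x : Hil) (n : ℤ) (m : ℕ) :
    chiMatrix hq 0 1 x (n, m) = -((q : ℂ) ^ (m + 1) * x (n - 1, m)) := by
  change -(star tOp (qN1 hq x) (n, m)) = _
  rw [star_tOp_apply, qN1, diagOp_apply]
  push_cast; rfl

theorem chiMatrix_apply_10 {q : ℝ} (hq : q ∈ Set.Ioo (0 : ℝ) 1) (x : Hil) (n : ℤ) (m : ℕ) :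
    chiMatrix hq 1 0 x (n, m) = (q : ℂ) ^ m * x (n + 1, m) := by
  change tOp (qN hq x) (n, m) = _
  rw [tOp_apply, qN, diagOp_apply]
  push_cast; rfl

theorem chiMatrix_apply_11_zero {q : ℝ} (hq : q ∈ Set.Ioo (0 : ℝ) 1) (x : Hil) (n : ℤ) :
    chiMatrix hq 1 1 x (n, 0) = 0 := by
  change tOp (star SOp (rootN hq x)) (n, 0) = _
  rw [tOp_apply, star_SOp_apply_zero]

theorem chiMatrix_apply_11_succ {q : ℝ} (hq : q ∈ Set.Ioo (0 : ℝ) 1) (x : Hil) (n : ℤ) (m : ℕ) :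
    chiMatrix hq 1 1 x (n, m + 1) =
      (Real.sqrt (1 - q ^ (2 * m + 2)) : ℂ) * x (n + 1, m) := by
  change tOp (star SOp (rootN hq x)) (n, m + 1) = _
  rw [tOp_apply, star_SOp_apply_succ, rootN, diagOp_apply]

theorem star_chiMatrix_00 {q : ℝ} (hq : q ∈ Set.Ioo (0 : ℝ) 1) :
    star (chiMatrix hq 0 0) = chiMatrix hq 1 1 := by
  ext x ⟨n, m⟩
  change star (star tOp * (rootN hq * SOp)) x (n, m) = _
  rw [star_mul, star_mul, star_star, rootN, star_diagOp]
  change star SOp (diagOp _ _ (tOp x)) (n, m) = _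
  rcases m with _ | m
  · rw [chiMatrix_apply_11_zero, star_SOp_apply_zero]
  · rw [chiMatrix_apply_11_succ, star_SOp_apply_succ, diagOp_apply, tOp_apply]

theorem star_chiMatrix_11 {q : ℝ} (hq : q ∈ Set.Ioo (0 : ℝ) 1) :
    star (chiMatrix hq 1 1) = chiMatrix hq 0 0 := by
  rw [← star_chiMatrix_00, star_star]

theorem star_chiMatrix_10_apply {q : ℝ} (hq : q ∈ Set.Ioo (0 : ℝ) 1) (x : Hil) (n : ℤ) (m : ℕ) :
    star (chiMatrix hq 1 0) x (n, m) = (q : ℂ) ^ m * x (n - 1, m) := by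
  change star (tOp * qN hq) x (n, m) = _
  rw [star_mul, qN, star_diagOp]
  change diagOp _ (abs_pow_le hq) (star tOp x) (n, m) = _
  rw [diagOp_apply, star_tOp_apply]
  push_cast; rfl

theorem star_chiMatrix_01_apply {q : ℝ} (hq : q ∈ Set.Ioo (0 : ℝ) 1) (x : Hil) (n : ℤ) (m : ℕ) :
    star (chiMatrix hq 0 1) x (n, m) = -((q : ℂ) ^ (m + 1) * x (n + 1, m)) := by
  change star (-(star tOp * qN1 hq)) x (n, m) = _
  rw [star_neg, star_mul, star_star, qN1, star_diagOp]
  change -(diagOp _ (fun m => abs_pow_le hq (m + 1)) (tOp x) (n, m)) = _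
  rw [diagOp_apply, tOp_apply]
  push_cast; rfl

theorem isCompactOperator_commutator_chiMatrix {q : ℝ} (hq : q ∈ Set.Ioo (0 : ℝ) 1) (k : ℤ)
    (i j : Fin 2) : IsCompactOperator (F k * chiMatrix hq i j - chiMatrix hq i j * F k) ∧
      IsCompactOperator (F k * star (chiMatrix hq i j) - star (chiMatrix hq i j) * F k) := by
  have h00 : F k * chiMatrix hq 0 0 - chiMatrix hq 0 0 * F k = 0 :=
    commutator_eq_zero_of_preserves k _ fun n m =>
      ⟨_, n - 1, m + 1, by push_cast; ring, fun x => chiMatrix_apply_00 hq x n m⟩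
  have h11 : F k * chiMatrix hq 1 1 - chiMatrix hq 1 1 * F k = 0 :=
    commutator_eq_zero_of_preserves k _ fun n m => by
      rcases m with _ | m
      · exact ⟨0, n, 0, rfl, fun x => by rw [chiMatrix_apply_11_zero, zero_mul]⟩
      · exact ⟨_, n + 1, m, by push_cast; ring, fun x => chiMatrix_apply_11_succ hq x n m⟩
  have h0 : IsCompactOperator (0 : Hil →L[ℂ] Hil) := isCompactOperator_zero
  match i, j with
  | 0, 0 => rw [star_chiMatrix_00, h00, h11]; exact ⟨h0, h0⟩
  | 1, 1 => rw [star_chiMatrix_11, h00, h11]; exact ⟨h0, h0⟩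
  | 0, 1 =>
    exact ⟨isCompactOperator_commutator_of_shift hq k _ (-q) (-1) (.inr rfl) fun x n m => by
        rw [chiMatrix_apply_01, ← sub_eq_add_neg]; ring,
      isCompactOperator_commutator_of_shift hq k _ (-q) 1 (.inl rfl) fun x n m => by
        rw [star_chiMatrix_01_apply]; ring⟩
  | 1, 0 =>
    exact ⟨isCompactOperator_commutator_of_shift hq k _ 1 1 (.inl rfl) fun x n m => by
        rw [chiMatrix_apply_10]; ring,
      isCompactOperator_commutator_of_shift hq k _ 1 (-1) (.inr rfl) fun x n m => by
        rw [star_chiMatrix_10_apply, ← sub_eq_add_neg]; ring⟩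

/-- The commutators of `G` with a representation of `C(SU_q(2))` are compact once they are compact
on the generators and their adjoints. -/
theorem isCompactOperator_commutator_lift {q : ℝ} {H : Type} [NormedAddCommGroup H]
    [InnerProductSpace ℂ H] [CompleteSpace H] [Nontrivial H] (G : H →L[ℂ] H)
    (u : Matrix (Fin 2) (Fin 2) (H →L[ℂ] H)) (hu : IsSUq2Matrix q u)
    (h : ∀ i j, IsCompactOperator (G * u i j - u i j * G) ∧
      IsCompactOperator (G * star (u i j) - star (u i j) * G)) (a : CSUq2 q) :
    IsCompactOperator (G * lift u hu a - lift u hu a * G) := by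
  let ρ : Realization q := ⟨H →L[ℂ] H, u, hu⟩
  let ev : Ambient q → (H →L[ℂ] H) := fun a => a ρ
  -- Evaluation at one realization is contractive for the supremum norm, so the condition on `a` is
  -- closed and needs checking only on the dense star subalgebra.
  have hev : Continuous ev :=
    LipschitzWith.continuous (K := 1) (LipschitzWith.of_dist_le_mul fun a b => by
      rw [dist_eq_norm, dist_eq_norm, NNReal.coe_one, one_mul]
      exact lp.norm_apply_le_norm (by simp) (a - b) ρ)
  have hcl : IsClosed {a : Ambient q | IsCompactOperator (G * ev a - ev a * G)} :=
    isClosed_setOfPred_isCompactOperator.preimage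
      (f := fun a => G * ev a - ev a * G) (by fun_prop)
  refine closure_minimal ?_ hcl a.2
  intro b hb
  -- Viewing the star subalgebra as the plain algebra generated by the generators and their adjoints
  -- removes the need for an induction step for `star`.
  replace hb : b ∈ Algebra.adjoin ℂ ((Set.range fun ij : Fin 2 × Fin 2 => ambientGen q ij.1 ij.2) ∪
    star (Set.range fun ij : Fin 2 × Fin 2 => ambientGen q ij.1 ij.2)) := hb
  change IsCompactOperator (G * ev b - ev b * G)
  induction hb using Algebra.adjoin_induction with
  | mem x hx =>
    rcases hx with ⟨ij, rfl⟩ | ⟨ij, hij⟩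
    · exact (h ij.1 ij.2).1
    · have : x = star (ambientGen q ij.1 ij.2) := by rw [← star_star x, ← hij]
      rw [this]
      exact (h ij.1 ij.2).2
  | algebraMap r =>
    have h1 : ev (algebraMap ℂ _ r) = algebraMap ℂ _ r := rfl
    have h2 : G * algebraMap ℂ _ r - algebraMap ℂ _ r * G = 0 := by
      rw [Algebra.commutes, sub_self]
    rw [h1, h2]
    exact isCompactOperator_zero
  | add x y _ _ hx hy =>
    have h1 : ev (x + y) = ev x + ev y := rfl
    have h2 : G * ev (x + y) - ev (x + y) * G = (G * ev x - ev x * G) + (G * ev y - ev y * G) := by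
      rw [h1]; noncomm_ring
    rw [h2]
    exact hx.add hy
  | mul x y _ _ hx hy =>
    have h1 : ev (x * y) = ev x * ev y := rfl
    have h2 : G * ev (x * y) - ev (x * y) * G =
        (G * ev x - ev x * G) * ev y + ev x * (G * ev y - ev y * G) := by
      rw [h1]; noncomm_ring
    rw [h2]
    exact (hx.comp_clm (ev y)).add (hy.clm_comp (ev x))

theorem isOddFredholmModule_chi {q : ℝ} (hq : q ∈ Set.Ioo (0 : ℝ) 1) (k : ℤ) :
    IsOddFredholmModule (chi hq) (F k) :=
  ⟨isSelfAdjoint_F k, F_mul_self k, fun a => isCompactOperator_commutator_lift (F k)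
    (chiMatrix hq) _ (isCompactOperator_commutator_chiMatrix hq k) a⟩

/-! ### The index of the fundamental unitary -/

/-- The coordinate functional `f ↦ (f i)(n, m)` on `N` copies of the positive space. -/
noncomputable def coordFunctional (k : ℤ) {N : ℕ} (i : Fin N) (n : ℤ) (m : ℕ) :
    (Fin N → posSpace (F k)) →L[ℂ] ℂ :=
  innerSL ℂ (e n m) ∘L (posSpace (F k)).subtypeL ∘L ContinuousLinearMap.proj i

theorem coordFunctional_apply (k : ℤ) {N : ℕ} (i : Fin N) (n : ℤ) (m : ℕ)
    (f : Fin N → posSpace (F k)) : coordFunctional k i n m f = (f i : Hil) (n, m) :=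
  inner_e n m (f i)

theorem coordFunctional_surjective (k : ℤ) {N : ℕ} (i : Fin N) {n : ℤ} {m : ℕ} (h : n + m ≤ k) :
    Function.Surjective (coordFunctional k i n m) := by
  have he : e n m ∈ posSpace (F k) := mem_posSpace_F.2 fun n' m' h' => by
    rw [e_apply, if_neg]
    rintro ⟨rfl, rfl⟩
    omega
  intro z
  refine ⟨fun _ => z • ⟨e n m, he⟩, ?_⟩
  rw [coordFunctional_apply]
  change z * e n m (n, m) = z
  rw [e_apply, if_pos ⟨rfl, rfl⟩, mul_one]

theorem posSpace_ext {k : ℤ} {N : ℕ} {f g : Fin N → posSpace (F k)}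
    (h : ∀ (i : Fin N) (n : ℤ) (m : ℕ), n + m ≤ k → (f i : Hil) (n, m) = (g i : Hil) (n, m)) :
    f = g := by
  ext i ⟨n, m⟩
  by_cases hnm : n + m ≤ k
  · exact h i n m hnm
  · rw [mem_posSpace_F.1 (f i).2 n m (not_le.1 hnm), mem_posSpace_F.1 (g i).2 n m (not_le.1 hnm)]

theorem chi_gen {q : ℝ} (hq : q ∈ Set.Ioo (0 : ℝ) 1) (i j : Fin 2) :
    chi hq (gen q i j) = chiMatrix hq i j := rfl

theorem compression_fundamental_fst {q : ℝ} (hq : q ∈ Set.Ioo (0 : ℝ) 1) (k : ℤ)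
    (f : Fin 2 → posSpace (F k)) {n : ℤ} {m : ℕ}
    (h : n + m ≤ k) :
    (compression (chi hq) (F k) (fundamentalUnitary q) f 0 : Hil) (n, m) =
      (Real.sqrt (1 - q ^ (2 * m + 2)) : ℂ) * (f 0 : Hil) (n - 1, m + 1)
        - (q : ℂ) ^ (m + 1) * (f 1 : Hil) (n - 1, m) := by
  rw [compression_F_apply, if_pos h, Fin.sum_univ_two]
  change chiMatrix hq 0 0 (f 0) (n, m) + chiMatrix hq 0 1 (f 1) (n, m) = _
  rw [chiMatrix_apply_00, chiMatrix_apply_01, ← sub_eq_add_neg]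

theorem compression_fundamental_snd_zero {q : ℝ} (hq : q ∈ Set.Ioo (0 : ℝ) 1) (k : ℤ)
    (f : Fin 2 → posSpace (F k)) {n : ℤ} (h : n ≤ k) :
    (compression (chi hq) (F k) (fundamentalUnitary q) f 1 : Hil) (n, 0) =
      (f 0 : Hil) (n + 1, 0) := by
  rw [compression_F_apply, if_pos (by simpa using h), Fin.sum_univ_two]
  change chiMatrix hq 1 0 (f 0) (n, 0) + chiMatrix hq 1 1 (f 1) (n, 0) = _
  rw [chiMatrix_apply_10, chiMatrix_apply_11_zero, pow_zero, one_mul, add_zero]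

theorem compression_fundamental_snd_succ {q : ℝ} (hq : q ∈ Set.Ioo (0 : ℝ) 1) (k : ℤ)
    (f : Fin 2 → posSpace (F k)) {n : ℤ} {m : ℕ}
    (h : n + m + 1 ≤ k) :
    (compression (chi hq) (F k) (fundamentalUnitary q) f 1 : Hil) (n, m + 1) =
      (q : ℂ) ^ (m + 1) * (f 0 : Hil) (n + 1, m + 1) +
      (Real.sqrt (1 - q ^ (2 * m + 2)) : ℂ) * (f 1 : Hil) (n + 1, m) := by
  rw [compression_F_apply, if_pos (by push_cast; omega), Fin.sum_univ_two]
  change chiMatrix hq 1 0 (f 0) (n, m + 1) + chiMatrix hq 1 1 (f 1) (n, m + 1) = _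
  rw [chiMatrix_apply_10, chiMatrix_apply_11_succ]

theorem one_sub_pow_pos {q : ℝ} (hq : q ∈ Set.Ioo (0 : ℝ) 1) (m : ℕ) : 0 < 1 - q ^ (2 * m + 2) :=
  sub_pos.2 (pow_lt_one₀ hq.1.le hq.2 (by omega))

theorem sqrt_mul_sqrt {q : ℝ} (hq : q ∈ Set.Ioo (0 : ℝ) 1) (m : ℕ) :
    (Real.sqrt (1 - q ^ (2 * m + 2)) : ℂ) * (Real.sqrt (1 - q ^ (2 * m + 2)) : ℂ) =
      1 - (q : ℂ) ^ (m + 1) * (q : ℂ) ^ (m + 1) := by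
  have := root_mul hq m 1
  rw [mul_one, mul_one] at this
  rw [this]; ring

theorem sqrt_ne_zero {q : ℝ} (hq : q ∈ Set.Ioo (0 : ℝ) 1) (m : ℕ) :
    (Real.sqrt (1 - q ^ (2 * m + 2)) : ℂ) ≠ 0 :=
  Complex.ofReal_ne_zero.2 (Real.sqrt_pos.2 (one_sub_pow_pos hq m)).ne'

theorem compression_fundamental_injective {q : ℝ} (hq : q ∈ Set.Ioo (0 : ℝ) 1) (k : ℤ) :
    Function.Injective (compression (chi hq) (F k) (fundamentalUnitary q)) := by
  rw [injective_iff_map_eq_zero]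
  intro f hf
  have hz : ∀ (i : Fin 2) (n : ℤ) (m : ℕ),
      (compression (chi hq) (F k) (fundamentalUnitary q) f i : Hil) (n, m) = 0 := fun i n m => by
    rw [hf]; rfl
  have hsucc : ∀ (n : ℤ) (m : ℕ), n + m ≤ k →
      (f 0 : Hil) (n, m + 1) = 0 ∧ (f 1 : Hil) (n, m) = 0 := by
    intro n m h
    have h2 := hz 1 (n - 1) (m + 1)
    rw [compression_fundamental_snd_succ hq k f (by omega), sub_add_cancel] at h2
    -- Below degree `k` both equations of the block are available and the transposed rotation
    -- inverts it. At `n + m = k` the first equation is cut off, but `f 0` vanishes at `(n, m + 1)`,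
    -- which has degree `k + 1`.
    rcases h.lt_or_eq with h | h
    · have h1 := hz 0 (n + 1) m
      rw [compression_fundamental_fst hq k f (by omega), add_sub_cancel_right] at h1
      have hs := sqrt_mul_sqrt hq m
      constructor
      · linear_combination (Real.sqrt (1 - q ^ (2 * m + 2)) : ℂ) * h1 + (q : ℂ) ^ (m + 1) * h2 -
          (f 0 : Hil) (n, m + 1) * hs
      · linear_combination (Real.sqrt (1 - q ^ (2 * m + 2)) : ℂ) * h2 - (q : ℂ) ^ (m + 1) * h1 -
          (f 1 : Hil) (n, m) * hs
    · have h0 : (f 0 : Hil) (n, m + 1) = 0 :=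
        mem_posSpace_F.1 (f 0).2 _ _ (by push_cast; omega)
      rw [h0, mul_zero, zero_add] at h2
      exact ⟨h0, (mul_eq_zero.1 h2).resolve_left (sqrt_ne_zero hq m)⟩
  refine posSpace_ext fun i n m h => ?_
  change (f i : Hil) (n, m) = 0
  match i, m with
  | 0, 0 =>
    have h2 := hz 1 (n - 1) 0
    rwa [compression_fundamental_snd_zero hq k f (by simp at h; omega), sub_add_cancel] at h2
  | 0, m + 1 => exact (hsucc n m (by push_cast at h; omega)).1
  | 1, m => exact (hsucc n m h).2

/-- The coordinates of degree `k` can be divided by `1 - q^{2m}`, `m ≥ 1`; this inverts `T T⋆` on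
the range of the compression `T` of the fundamental unitary. -/
theorem exists_divide {q : ℝ} (hq : q ∈ Set.Ioo (0 : ℝ) 1) (k : ℤ) (η : Hil) : ∃ η' : Hil,
    (∀ (n : ℤ) (m : ℕ), n + m < k → η' (n, m) = η (n, m)) ∧
    (∀ (n : ℤ) (m : ℕ), n + m = k - 1 →
      (1 - (q : ℂ) ^ (m + 1) * (q : ℂ) ^ (m + 1)) * η' (n, m + 1) = η (n, m + 1)) := by
  have hpos : 0 < 1 - q ^ 2 := one_sub_pow_pos hq 0
  have hle : ∀ m : ℕ, 1 - q ^ 2 ≤ 1 - q ^ (2 * m + 2) := fun m =>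
    sub_le_sub_left (pow_le_pow_of_le_one hq.1.le hq.2.le (by omega)) _
  -- The desired multiplier is scaled by `1 - q ^ 2`, the least of the divisors, to fit the bound
  -- `1` required by `weightedComp`; the scaling is undone afterwards.
  let w : ℤ × ℕ → ℝ := fun i => if i.1 + i.2 = k ∧ i.2 ≠ 0 then (1 - q ^ 2) / (1 - q ^ (2 * i.2))
    else 1 - q ^ 2
  have hw : ∀ i, ‖(w i : ℂ)‖ ≤ 1 := fun ⟨n, m⟩ => by
    rw [Complex.norm_real, Real.norm_eq_abs]
    simp only [w]
    split_ifs with h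
    · obtain ⟨m, rfl⟩ := Nat.exists_eq_succ_of_ne_zero h.2
      have h1 := one_sub_pow_pos hq m
      rw [Nat.mul_succ, abs_of_nonneg (div_nonneg hpos.le h1.le)]
      exact div_le_one_of_le₀ (hle m) h1.le
    · rw [abs_of_pos hpos]
      nlinarith [hq.1]
  have hc : ((1 - q ^ 2 : ℝ) : ℂ) ≠ 0 := Complex.ofReal_ne_zero.2 hpos.ne'
  let D := weightedComp (fun i => (w i : ℂ)) hw id Function.injective_id
  have hD : ∀ n m, (((1 - q ^ 2 : ℝ) : ℂ)⁻¹ • D η) (n, m) =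
      ((1 - q ^ 2 : ℝ) : ℂ)⁻¹ * ((w (n, m) : ℂ) * η (n, m)) := fun _ _ => rfl
  refine ⟨((1 - q ^ 2 : ℝ) : ℂ)⁻¹ • D η, fun n m h => ?_, fun n m h => ?_⟩
  · have : w (n, m) = 1 - q ^ 2 := if_neg fun h' => by simp at h'; omega
    rw [hD, this, inv_mul_cancel_left₀ hc]
  · have : w (n, m + 1) = (1 - q ^ 2) / (1 - q ^ (2 * m + 2)) :=
      if_pos ⟨by push_cast; omega, by simp⟩
    have h1 : (1 - (q : ℂ) ^ (m + 1) * (q : ℂ) ^ (m + 1)) = ((1 - q ^ (2 * m + 2) : ℝ) : ℂ) := by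
      push_cast; ring
    have h2 : ((1 - q ^ (2 * m + 2) : ℝ) : ℂ) ≠ 0 :=
      Complex.ofReal_ne_zero.2 (one_sub_pow_pos hq m).ne'
    rw [hD, this, h1, Complex.ofReal_div]
    field_simp

theorem compression_fundamental_range {q : ℝ} (hq : q ∈ Set.Ioo (0 : ℝ) 1) (k : ℤ) :
    (compression (chi hq) (F k) (fundamentalUnitary q)).range = (coordFunctional k 1 k 0).ker := by
  apply le_antisymm
  · rintro _ ⟨f, rfl⟩
    change coordFunctional k 1 k 0 (compression (chi hq) (F k) (fundamentalUnitary q) f) = 0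
    rw [coordFunctional_apply, compression_fundamental_snd_zero hq k f le_rfl]
    exact mem_posSpace_F.1 (f 0).2 _ _ (by simp)
  · intro g hg
    have hg' : (g 1 : Hil) (k, 0) = 0 := by rw [← coordFunctional_apply]; exact hg
    obtain ⟨η, hη, hηk⟩ := exists_divide hq k (g 1 : Hil)
    let π := (posSpace (F k)).orthogonalProjectionOnto
    -- The preimage is `T⋆(TT⋆)⁻¹g`. On the hyperplane `TT⋆` is the identity except at the degree
    -- `k` coordinates of component 1 with `m ≥ 1`, where it multiplies by `1 - q^{2m}`; `η` is `g
    -- 1` with this factor divided out.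
    let f : Fin 2 → posSpace (F k) :=
      ![π (star (chiMatrix hq 0 0) (g 0) + star (chiMatrix hq 1 0) η),
        π (star (chiMatrix hq 0 1) (g 0) + star (chiMatrix hq 1 1) η)]
    have hx0 : ∀ n : ℤ, n ≤ k → (f 0 : Hil) (n, 0) = η (n - 1, 0) := fun n h => by
      change (π _ : Hil) (n, 0) = _
      rw [orthogonalProjectionOnto_posSpace_apply, if_pos (by simpa using h), hil_add_apply,
        star_chiMatrix_00, chiMatrix_apply_11_zero, star_chiMatrix_10_apply]
      simp
    have hx : ∀ (n : ℤ) (m : ℕ), n + m + 1 ≤ k → (f 0 : Hil) (n, m + 1) =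
        (Real.sqrt (1 - q ^ (2 * m + 2)) : ℂ) * (g 0 : Hil) (n + 1, m) +
          (q : ℂ) ^ (m + 1) * η (n - 1, m + 1) := fun n m h => by
      change (π _ : Hil) (n, m + 1) = _
      rw [orthogonalProjectionOnto_posSpace_apply, if_pos (by push_cast; omega), hil_add_apply,
        star_chiMatrix_00, chiMatrix_apply_11_succ, star_chiMatrix_10_apply]
    have hy : ∀ (n : ℤ) (m : ℕ), n + m ≤ k → (f 1 : Hil) (n, m) =
        -((q : ℂ) ^ (m + 1) * (g 0 : Hil) (n + 1, m)) +
          (Real.sqrt (1 - q ^ (2 * m + 2)) : ℂ) * η (n - 1, m + 1) := fun n m h => by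
      change (π _ : Hil) (n, m) = _
      rw [orthogonalProjectionOnto_posSpace_apply, if_pos h, hil_add_apply,
        star_chiMatrix_11, chiMatrix_apply_00, star_chiMatrix_01_apply]
    refine ⟨f, posSpace_ext fun i n m h => ?_⟩
    change (compression (chi hq) (F k) (fundamentalUnitary q) f i : Hil) (n, m) = _
    match i, m with
    | 0, m =>
      have hs := sqrt_mul_sqrt hq m
      rw [compression_fundamental_fst hq k f h, hx _ _ (by omega), hy _ _ (by omega),
        sub_add_cancel]
      linear_combination (g 0 : Hil) (n, m) * hs
    | 1, 0 =>
      have h : n ≤ k := by simpa using h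
      rw [compression_fundamental_snd_zero hq k f h]
      rcases h.lt_or_eq with h | rfl
      · rw [hx0 _ (by omega), add_sub_cancel_right, hη _ _ (by simpa using h)]
      · rw [hg', mem_posSpace_F.1 (f 0).2 _ _ (by simp)]
    | 1, m + 1 =>
      have hs := sqrt_mul_sqrt hq m
      have h : n + m + 1 ≤ k := by push_cast at h; omega
      rw [compression_fundamental_snd_succ hq k f h, hy _ _ (by omega), add_sub_cancel_right]
      rcases h.lt_or_eq with h | h
      · rw [hx _ _ (by omega), add_sub_cancel_right, ← hη n (m + 1) (by push_cast; omega)]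
        linear_combination η (n, m + 1) * hs
      -- In degree `k` the terms from `f 0` and `g 0` have degree `k + 1` and vanish, which leaves
      -- the factor absorbed by `η`.
      · rw [mem_posSpace_F.1 (f 0).2 _ _ (by push_cast; omega),
          mem_posSpace_F.1 (g 0).2 _ _ (by omega), ← hηk n m (by omega)]
        linear_combination η (n, m + 1) * hs

theorem isFredholm_and_index_fundamentalUnitary {q : ℝ} (hq : q ∈ Set.Ioo (0 : ℝ) 1) (k : ℤ) :
    (compression (chi hq) (F k) (fundamentalUnitary q)).IsFredholm ∧
      indexPairing (chi hq) (F k) (fundamentalUnitary q) = -1 :=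
  isFredholm_and_fredholmIndex_of_range_eq_ker _ _ (compression_fundamental_injective hq k)
    (coordFunctional_surjective k 1 (by simp)) (compression_fundamental_range hq k)

/-! ### The unitary `v` -/

/-! ### Consequences of the relations in an arbitrary C⋆-algebra -/

section Relations

variable {q : ℝ} {B : Type*} [CStarAlgebra B] {u : Matrix (Fin 2) (Fin 2) B}

/-- The `E`-relations, rescaled, make the displayed matrix a right inverse of `u`, while unitarity
makes `star u` a left inverse. -/
theorem IsSUq2Matrix.star_eq (h : IsSUq2Matrix q u) (hq : q ≠ 0) :
    star u = !![u 1 1, -((q : ℂ)⁻¹ • u 0 1); -((q : ℂ) • u 1 0), u 0 0] := by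
  have hq' : (q : ℂ) ≠ 0 := Complex.ofReal_ne_zero.2 hq
  have h1 : star u * u = 1 := by
    ext1 i j
    exact (h.col i j).trans Matrix.one_apply.symm
  refine left_inv_eq_right_inv h1 ?_
  have h00 := h.det 0 0
  have h01 := h.det 0 1
  have h10 := h.det 1 0
  have h11 := h.det 1 1
  simp only [detCoeff, Fin.sum_univ_two, Matrix.of_apply, Matrix.cons_val', Matrix.cons_val_zero,
    Matrix.cons_val_one, zero_smul, one_smul, zero_add, add_zero,
    Matrix.cons_val_fin_one, neg_smul] at h00 h01 h10 h11
  ext1 i j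
  rw [Matrix.mul_apply, Fin.sum_univ_two]
  match i, j with
  | 0, 0 => simpa using h01
  | 0, 1 =>
    have := congrArg (fun z => -((q : ℂ)⁻¹ • z)) h00
    simp [smul_add, smul_smul, hq', -Complex.coe_smul] at this
    simpa [add_comm, -Complex.coe_smul] using this
  | 1, 0 => simpa using h11
  | 1, 1 =>
    have := congrArg (fun z => -((q : ℂ)⁻¹ • z)) h10
    simp [smul_add, smul_smul, hq', -Complex.coe_smul] at this
    simpa [add_comm, -Complex.coe_smul] using this

theorem IsSUq2Matrix.star_mul_self_00 (h : IsSUq2Matrix q u) :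
    star (u 0 0) * u 0 0 = 1 - star (u 1 0) * u 1 0 := by
  have := h.col 0 0
  rw [Fin.sum_univ_two, if_pos rfl] at this
  exact eq_sub_of_add_eq this

theorem IsSUq2Matrix.mul_star_self_00 (h : IsSUq2Matrix q u) (hq : q ≠ 0) :
    u 0 0 * star (u 0 0) = 1 - (q ^ 2) • (star (u 1 0) * u 1 0) := by
  have h1 := h.row 0 0
  rw [Fin.sum_univ_two, if_pos rfl] at h1
  have h2 : star (u 0 1) = -((q : ℂ) • u 1 0) := congrFun (congrFun (h.star_eq hq) 1) 0
  have h3 : u 0 1 = -((q : ℂ) • star (u 1 0)) := by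
    rw [← star_star (u 0 1), h2, star_neg, star_smul]
    simp
  rw [h2, h3] at h1
  rw [← h1]
  simp [smul_smul, ← pow_two]

/-- Normality of `z = u 1 0`: the second column relation reads `q² z z⋆ + u₁₁u₁₁⋆ = 1`, and the
first row gives the same with `z⋆ z`. -/
theorem IsSUq2Matrix.mul_star_self_10 (h : IsSUq2Matrix q u) (hq : q ≠ 0) :
    u 1 0 * star (u 1 0) = star (u 1 0) * u 1 0 := by
  have h1 := h.col 1 1
  have h0 := h.mul_star_self_00 hq
  rw [Fin.sum_univ_two, if_pos rfl] at h1
  have h2 : star (u 0 1) = -((q : ℂ) • u 1 0) := congrFun (congrFun (h.star_eq hq) 1) 0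
  have h3 : u 0 1 = -((q : ℂ) • star (u 1 0)) := by
    rw [← star_star (u 0 1), h2, star_neg, star_smul]
    simp
  have h4 : star (u 1 1) = u 0 0 := congrFun (congrFun (h.star_eq hq) 1) 1
  have h5 : u 1 1 = star (u 0 0) := by rw [← h4, star_star]
  rw [h2, h3, h4, h5, h0] at h1
  have h6 : (q ^ 2) • (u 1 0 * star (u 1 0)) = (q ^ 2) • (star (u 1 0) * u 1 0) := by
    have h7 : -((q : ℂ) • u 1 0) * -((q : ℂ) • star (u 1 0)) =
        (q ^ 2) • (u 1 0 * star (u 1 0)) := by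
      simp [smul_smul, ← pow_two]
    rw [h7] at h1
    rw [eq_sub_of_add_eq h1, sub_sub_cancel]
  exact smul_right_injective _ (pow_ne_zero 2 hq) h6

/-- The spectrum of `u₂₁⋆ u₂₁` has a gap between `q²` and `1`. -/
theorem IsSUq2Matrix.spectrum_gap (h : IsSUq2Matrix q u) (hq : q ∈ Set.Ioo (0 : ℝ) 1) {s : ℝ}
    (hs : s ∈ spectrum ℝ (star (u 1 0) * u 1 0)) : s ≤ q ^ 2 ∨ s = 1 := by
  have hq2 : 0 < q ^ 2 := pow_pos hq.1 2
  by_contra! hcon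
  have hle : ∀ s ∈ spectrum ℝ (star (u 1 0) * u 1 0), s ≤ 1 := fun s hs => by
    rcases subsingleton_or_nontrivial B with hB | hB
    · simp [spectrum.of_subsingleton] at hs
    have h1 := spectrum.norm_le_norm_of_mem hs
    rw [CStarRing.norm_star_mul_self] at h1
    have h2 := h.norm_entry_le 1 0
    nlinarith [norm_nonneg (u 1 0), le_abs_self s, Real.norm_eq_abs s]
  -- The elements `u₁₁⋆u₁₁ = 1 - z⋆z` and `u₁₁u₁₁⋆ = 1 - q² z⋆z` have the same nonzero spectrum. As
  -- `1 - s ≠ 0`, `s` lies in `q²` times a spectrum bounded by `1`.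
  have h1 : 1 - s ∈ spectrum ℝ (star (u 0 0) * u 0 0) := by
    rw [h.star_mul_self_00, ← map_one (algebraMap ℝ B), ← spectrum.singleton_sub_eq]
    exact ⟨1, rfl, s, hs, rfl⟩
  have h2 : 1 - s ∈ spectrum ℝ (u 0 0 * star (u 0 0)) \ {0} := by
    rw [spectrum.nonzero_mul_comm]
    exact ⟨h1, by simpa [sub_eq_zero] using hcon.2.symm⟩
  rw [h.mul_star_self_00 hq.1.ne', ← map_one (algebraMap ℝ B), ← spectrum.singleton_sub_eq] at h2
  obtain ⟨⟨_, rfl, s', hs', hss'⟩, -⟩ := h2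
  have h3 : s' = s := by simpa using hss'
  rw [h3, ← Units.val_mk0 hq2.ne', ← Units.smul_def, spectrum.unit_smul_eq_smul] at hs'
  obtain ⟨s'', hs'', hss''⟩ := hs'
  have h4 : q ^ 2 * s'' = s := hss''
  have := hle s'' hs''
  nlinarith [hcon.1]

/-- If `z` is normal and the spectrum of `z⋆ z` has a gap below `1`, the spectral projection of
`z⋆ z` at `1`. -/
theorem exists_spectralProjection (z : B) (hz : z * star z = star z * z) {c : ℝ} (hc : c < 1)
    (hgap : ∀ s ∈ spectrum ℝ (star z * z), s ≤ c ∨ s = 1) :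
    ∃ r g : B, star r = r ∧ r * r = r ∧ Commute z r ∧ star z * z * r = r ∧
      1 - r = g * (1 - star z * z) := by
  set x := star z * z with hx
  have hsa : IsSelfAdjoint x := IsSelfAdjoint.star_mul_self z
  -- On the spectrum `f` is the indicator of `1`. Truncating at `c` keeps `g` continuous, with `g s
  -- * (1 - s) = 1` for `s ≤ c`; at `s = 1` its value is irrelevant.
  let f : ℝ → ℝ := fun s => max 0 ((s - c) / (1 - c))
  let g : ℝ → ℝ := fun s => (1 - min s c)⁻¹
  have hc' : (0 : ℝ) < 1 - c := sub_pos.2 hc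
  have hg0 : ∀ s, 1 - min s c ≠ 0 := fun s => by
    have := min_le_right s c
    linarith
  have hf : Continuous f := by fun_prop
  have hg : Continuous g := Continuous.inv₀ (by fun_prop) hg0
  have hf0 : ∀ s ≤ c, f s = 0 := fun s hs =>
    max_eq_left (div_nonpos_of_nonpos_of_nonneg (by linarith) hc'.le)
  have hf1 : f 1 = 1 := by simp [f, div_self hc'.ne']
  refine ⟨cfc f x, cfc g x, IsSelfAdjoint.star_eq (cfc_predicate f x), ?_, ?_, ?_, ?_⟩
  · rw [← cfc_mul f f x hf.continuousOn hf.continuousOn]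
    refine cfc_congr fun s hs => ?_
    rcases hgap s hs with h | rfl
    · simp [hf0 s h]
    · simp [hf1]
  · refine (Commute.cfc_real ?_ f).symm
    change star z * z * z = z * (star z * z)
    rw [← mul_assoc, hz]
  · nth_rw 1 [← cfc_id ℝ x]
    rw [← cfc_mul id f x continuousOn_id hf.continuousOn]
    refine cfc_congr fun s hs => ?_
    rcases hgap s hs with h | rfl
    · simp [hf0 s h]
    · simp [hf1]
  · have h1 : 1 - cfc f x = cfc (fun s => 1 - f s) x := by
      rw [cfc_sub (fun _ => 1) f x continuousOn_const hf.continuousOn, cfc_const_one ℝ x]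
    have h2 : 1 - x = cfc (fun s : ℝ => 1 - s) x := by
      rw [cfc_sub (fun _ => 1) (fun s => s) x continuousOn_const continuousOn_id,
        cfc_const_one ℝ x, cfc_id' ℝ x]
    rw [h1, h2, ← cfc_mul g (fun s => 1 - s) x hg.continuousOn (by fun_prop)]
    refine cfc_congr fun s hs => ?_
    rcases hgap s hs with h | rfl
    · have := hg0 s
      simp only [g, hf0 s h, min_eq_left h] at this ⊢
      field_simp
      simp
    · simp [hf1]

/-- On the range of `r` the normal element `z` is unitary, and `1` is placed on the complement. -/
theorem mul_add_one_sub_mem_unitary {z r : B} (hz : z * star z = star z * z) (hr : star r = r)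
    (hrr : r * r = r) (hzr : Commute z r) (hx : star z * z * r = r) :
    z * r + 1 - r ∈ unitary B := by
  have hzr' : star z * r = r * star z := by
    have := congrArg star hzr.eq
    rw [star_mul, star_mul, hr] at this
    exact this.symm
  have hs : star (z * r + 1 - r) = star z * r + 1 - r := by
    rw [star_sub, star_add, star_mul, hr, star_one, hzr']
  have key : ∀ a b : B, b * r = r * b → a * b * r = r → (a * r + 1 - r) * (b * r + 1 - r) = 1 := by
    intro a b hb hab
    have h1 : a * r * (b * r) = r := by
      rw [hb, mul_assoc a, ← mul_assoc r, hrr, ← hb, ← mul_assoc, hab]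
    have h2 : r * (b * r) = b * r := by rw [hb, ← mul_assoc, hrr]
    have h3 : a * r * r = a * r := by rw [mul_assoc, hrr]
    calc (a * r + 1 - r) * (b * r + 1 - r)
        = a * r * (b * r) + (a * r - a * r * r) + (b * r - r * (b * r)) + 1 - r - r + r * r := by
          noncomm_ring
      _ = 1 := by rw [h1, h2, h3, hrr]; noncomm_ring
  rw [Unitary.mem_iff, hs]
  exact ⟨key _ _ hzr.eq hx, key _ _ hzr' (by rw [hz, hx])⟩

end Relations

/-! ### The projection `p`, the lift of `v` and its index -/

theorem pOp_apply_zero (x : Hil) (n : ℤ) : pOp x (n, 0) = x (n, 0) := by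
  change x (n, 0) - star SOp (SOp x) (n, 0) = _
  rw [star_SOp_apply_zero, sub_zero]

theorem pOp_apply_succ (x : Hil) (n : ℤ) (m : ℕ) : pOp x (n, m + 1) = 0 := by
  change x (n, m + 1) - star SOp (SOp x) (n, m + 1) = _
  rw [star_SOp_apply_succ, SOp_apply, sub_self]

theorem star_pOp : star pOp = pOp := by
  simp [pOp]

/-- An operator which behaves like the spectral projection of `q^{2N}` at `1` equals `p`. -/
theorem eq_pOp {q : ℝ} (hq : q ∈ Set.Ioo (0 : ℝ) 1) {r g : Hil →L[ℂ] Hil} (hr : star r = r)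
    (hx : star (chiMatrix hq 1 0) * chiMatrix hq 1 0 * r = r)
    (hg : 1 - r = g * (1 - star (chiMatrix hq 1 0) * chiMatrix hq 1 0)) : r = pOp := by
  have hX : ∀ y n m, (star (chiMatrix hq 1 0) * chiMatrix hq 1 0) y (n, m) =
      (q : ℂ) ^ m * (q : ℂ) ^ m * y (n, m) := fun y n m => by
    change star (chiMatrix hq 1 0) (chiMatrix hq 1 0 y) (n, m) = _
    rw [star_chiMatrix_10_apply, chiMatrix_apply_10, sub_add_cancel, mul_assoc]
  have h1 : pOp * r = r := by
    ext y ⟨n, m⟩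
    change pOp (r y) (n, m) = r y (n, m)
    rcases m with _ | m
    · rw [pOp_apply_zero]
    · rw [pOp_apply_succ]
      have h2 : (star (chiMatrix hq 1 0) * chiMatrix hq 1 0) (r y) (n, m + 1) =
        r y (n, m + 1) := congrArg (fun T : Hil →L[ℂ] Hil => T y (n, m + 1)) hx
      rw [hX, ← pow_add, show m + 1 + (m + 1) = 2 * m + 2 by ring] at h2
      have h3 : (1 - (q : ℂ) ^ (2 * m + 2)) ≠ 0 := by
        exact_mod_cast (one_sub_pow_pos hq m).ne'
      refine ((mul_eq_zero.1 ?_).resolve_left h3).symm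
      linear_combination -h2
  have h2 : (1 - star (chiMatrix hq 1 0) * chiMatrix hq 1 0) * pOp = 0 := by
    ext y ⟨n, m⟩
    change pOp y (n, m) - (star (chiMatrix hq 1 0) * chiMatrix hq 1 0) (pOp y) (n, m) = 0
    rw [hX]
    rcases m with _ | m
    · simp
    · rw [pOp_apply_succ]; simp
  have h3 : r * pOp = pOp := by
    have h4 : (1 - r) * pOp = 0 := by rw [hg, mul_assoc, h2, mul_zero]
    rw [sub_mul, one_mul, sub_eq_zero] at h4
    exact h4.symm
  -- The adjoint of `r p = p` is `p r = p`, to be compared with `p r = r`.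
  have h5 := congrArg star h3
  rw [star_mul, star_pOp, hr, h1] at h5
  exact h5

theorem exists_unitary_chi_eq {q : ℝ} (hq : q ∈ Set.Ioo (0 : ℝ) 1) :
    ∃ v : unitary (Matrix (Fin 1) (Fin 1) (CSUq2 q)),
      chi hq (v.1 0 0) = tOp * pOp + 1 - pOp := by
  have hu := isSUq2Matrix_gen q
  have hnormal := hu.mul_star_self_10 hq.1.ne'
  obtain ⟨r, g, hr, hrr, hcomm, hx, hg⟩ := exists_spectralProjection (gen q 1 0) hnormal
    (pow_lt_one₀ hq.1.le hq.2 two_ne_zero) fun s hs => hu.spectrum_gap hq hs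
  have hv := mul_add_one_sub_mem_unitary hnormal hr hrr hcomm hx
  set v := gen q 1 0 * r + 1 - r with hvdef
  have hchir : chi hq r = pOp := by
    refine eq_pOp hq (g := chi hq g) ?_ ?_ ?_
    · rw [← map_star, hr]
    · rw [← chi_gen, ← map_star, ← map_mul, ← map_mul, hx]
    · rw [← chi_gen, ← map_star, ← map_mul, ← map_one (chi hq), ← map_sub, ← map_sub, ← map_mul,
        hg]
  have hchiv : chi hq v = tOp * pOp + 1 - pOp := by
    have h1 : chiMatrix hq 1 0 * pOp = tOp * pOp := by
      ext y ⟨n, m⟩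
      change chiMatrix hq 1 0 (pOp y) (n, m) = tOp (pOp y) (n, m)
      rw [chiMatrix_apply_10, tOp_apply]
      rcases m with _ | m
      · simp
      · rw [pOp_apply_succ, mul_zero]
    rw [hvdef, map_sub, map_add, map_mul, map_one, hchir, chi_gen, h1]
  refine ⟨⟨Matrix.of fun _ _ => v, ?_⟩, hchiv⟩
  rw [Unitary.mem_iff] at hv ⊢
  constructor
  · ext1 i j
    rw [Matrix.mul_apply, Fin.sum_univ_one, Subsingleton.elim i j, Matrix.one_apply_eq]
    exact hv.1
  · ext1 i j
    rw [Matrix.mul_apply, Fin.sum_univ_one, Subsingleton.elim i j, Matrix.one_apply_eq]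
    exact hv.2

theorem isFredholm_and_index_of_eq {A : Type*} [CStarAlgebra A]
    (π : A →⋆ₐ[ℂ] (Hil →L[ℂ] Hil)) (k : ℤ) (v : unitary (Matrix (Fin 1) (Fin 1) A))
    (hv : π (v.1 0 0) = tOp * pOp + 1 - pOp) :
    (compression π (F k) v).IsFredholm ∧ indexPairing π (F k) v = -1 := by
  have hT0 : ∀ f, ∀ n ≤ k, (compression π (F k) v f 0 : Hil) (n, 0) = (f 0 : Hil) (n + 1, 0) := by
    intro f n h
    rw [compression_F_apply, if_pos (by simpa using h), Fin.sum_univ_one, hv]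
    change tOp (pOp (f 0)) (n, 0) + (f 0 : Hil) (n, 0) - pOp (f 0) (n, 0) = _
    rw [tOp_apply, pOp_apply_zero, pOp_apply_zero, add_sub_cancel_right]
  have hT1 : ∀ f, ∀ (n : ℤ) (m : ℕ), n + m + 1 ≤ k →
      (compression π (F k) v f 0 : Hil) (n, m + 1) = (f 0 : Hil) (n, m + 1) := by
    intro f n m h
    rw [compression_F_apply, if_pos (by push_cast; omega), Fin.sum_univ_one, hv]
    change tOp (pOp (f 0)) (n, m + 1) + (f 0 : Hil) (n, m + 1) - pOp (f 0) (n, m + 1) = _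
    rw [tOp_apply, pOp_apply_succ, pOp_apply_succ, zero_add, sub_zero]
  refine isFredholm_and_fredholmIndex_of_range_eq_ker _ (coordFunctional k 0 k 0) ?_
    (coordFunctional_surjective k 0 (by simp)) (le_antisymm ?_ ?_)
  · rw [injective_iff_map_eq_zero]
    intro f hf
    have hz : ∀ (n : ℤ) (m : ℕ), (compression π (F k) v f 0 : Hil) (n, m) = 0 := fun n m => by
      rw [hf]; rfl
    refine posSpace_ext fun i n m h => ?_
    rw [Subsingleton.elim i 0]
    change (f 0 : Hil) (n, m) = 0
    rcases m with _ | m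
    · rw [← hz (n - 1) 0, hT0 _ _ (by simp at h; omega), sub_add_cancel]
    · rw [← hz n (m + 1), hT1 _ _ _ (by push_cast at h; omega)]
  · rintro _ ⟨f, rfl⟩
    change coordFunctional k 0 k 0 (compression π (F k) v f) = 0
    rw [coordFunctional_apply, hT0 f k le_rfl]
    exact mem_posSpace_F.1 (f 0).2 _ _ (by simp)
  · intro g hg
    have hg' : (g 0 : Hil) (k, 0) = 0 := by rw [← coordFunctional_apply]; exact hg
    -- The candidate preimage is the adjoint operator `t⋆ ⊗ p + 1 - 1 ⊗ p` applied to `g`, then cut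
    -- off; the cutoff loses only what the hyperplane condition makes zero.
    let y : Hil := star tOp (pOp (g 0)) + (g 0 : Hil) - pOp (g 0)
    have hy : ∀ n m, y (n, m) =
        star tOp (pOp (g 0)) (n, m) + (g 0 : Hil) (n, m) - pOp (g 0) (n, m) := fun _ _ => rfl
    let f : Fin 1 → posSpace (F k) := fun _ => (posSpace (F k)).orthogonalProjectionOnto y
    have hf : ∀ (n : ℤ) (m : ℕ), n + m ≤ k → (f 0 : Hil) (n, m) = y (n, m) := fun n m h => by
      rw [orthogonalProjectionOnto_posSpace_apply, if_pos h]
    refine ⟨f, posSpace_ext fun i n m h => ?_⟩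
    rw [Subsingleton.elim i 0]
    change (compression π (F k) v f 0 : Hil) (n, m) = _
    rcases m with _ | m
    · have h : n ≤ k := by simpa using h
      rw [hT0 _ _ h]
      rcases h.lt_or_eq with h | rfl
      · rw [hf _ _ (by simp; omega), hy, star_tOp_apply, pOp_apply_zero, pOp_apply_zero,
          add_sub_cancel_right, add_sub_cancel_right]
      · rw [hg', mem_posSpace_F.1 (f 0).2 _ _ (by simp)]
    · rw [hT1 _ _ _ (by push_cast at h; omega), hf _ _ h, hy, star_tOp_apply, pOp_apply_succ,
        pOp_apply_succ, zero_add, sub_zero]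

end QuantumSU2

open QuantumSU2 in
theorem mainTheorem6 (q : ℝ) (hq : q ∈ Set.Ioo (0 : ℝ) 1) (k : ℤ) :
    IsOddFredholmModule (chi hq) (F k) ∧
    ((compression (chi hq) (F k) (fundamentalUnitary q)).IsFredholm ∧
      indexPairing (chi hq) (F k) (fundamentalUnitary q) = -1) ∧
    ∃ v : unitary (Matrix (Fin 1) (Fin 1) (CSUq2 q)),
      chi hq (v.1 0 0) = tOp * pOp + 1 - pOp ∧
      (compression (chi hq) (F k) v).IsFredholm ∧
      indexPairing (chi hq) (F k) v = -1 := by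
  obtain ⟨v, hv⟩ := exists_unitary_chi_eq hq
  exact ⟨isOddFredholmModule_chi hq k, isFredholm_and_index_fundamentalUnitary hq k, v, hv,
    isFredholm_and_index_of_eq (chi hq) k v hv⟩
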